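/- Let $f\in\mathbb C[x_1,\dots,x_n]$ be a non-zero polynomial with $f(0)=0$, and let $\Gamma_+(f)\subset\mathbb R_+^n$ be its Newton polyhedron at the origin, i.e. the convex hull of $\bigcup_{m\in\operatorname{supp} f}(m+\mathbb R_+^n)$. Let $\tau$ be an $(n-1)$-dimensional lattice simplex contained in a compact facet of $\Gamma_+(f)$. Let $i_1<\dots<i_r$ be precisely the indices $i$ for which $\tau\cap\{v_i=0\}$ is a facet of $\tau$. Assume that $r\ge 1$ and that $\tau\cap\{v_{i_1}=\dots=v_{i_r}=0\}\neq\emptyset$ (that is, $\tau$ has a non-empty corner of codimension $r$). For a lattice polytope $\sigma\subset\tau$ let $\operatorname{Vol}_{\mathbb Z}(\sigma)$ be its normalized volume, i.e. $(\dim\sigma)!$ times its usual volume with respect to the affine lattice $\operatorname{aff}(\sigma)\cap\mathbb Z^n$. Let $N(\sigma)$ be the lattice distance of $\operatorname{aff}(\sigma)$ from the origin, i.e. the constant positive value on $\sigma$ of the linear form on the linear span of $\sigma$ that is constant on $\sigma$, positive there, and maps the integral points of this span onto $\mathbb Z$. Put $\zeta_\sigma(t)=(1-t^{N(\sigma)})^{\operatorname{Vol}_{\mathbb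 Z}(\sigma)}$ and $$F_\tau(t)=\prod_{I\subset\{i_1,\dots,i_r\}}\bigl\{\zeta_{\tau\cap\{v_i=0\ (i\in I)\}}(t)\bigr\}^{(-1)^{|I|}}\in\mathbb C(t).$$ Let $a(\tau)\in\mathbb Z_+^n$ be the primitive conormal vector of $\tau$, i.e. the vector with non-negative coprime integral coordinates for which $\langle a(\tau),\cdot\rangle$ is constant on $\tau$, and let $\nu(\tau)=\sum_i a(\tau)_i$. Then $F_\tau(t)$ is a polynomial in $t$. If moreover $\tau$ is not a $B_1$-pyramid, then $\lambda=\exp\bigl(-2\pi i\,\nu(\tau)/N(\tau)\bigr)$ is a root of this polynomial. Here an $(n-1)$-dimensional polyhedron $\tau\subset\mathbb R_+^n$ is a $B_1$-pyramid of compact type for the variable $v_i$ if it is a compact pyramid over the base $\tau\cap\{v_i=0\}$ whose unique vertex outside the base has $v_i$-coordinate $1$. It is a $B_1$-pyramid of non-compact type if there is a non-empty $S\subset\{1,\dots,n\}$ with $\tau+\mathbb R_+^S\subset\tau$ such that the projection of $\tau$ to $\mathbb R_+^{S^c}$ is a $B_1$-pyramid of compact type for some variable $v_i$ with $i\notin S$.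 It is a $B_1$-pyramid if it is of one of these two types. -/

import Mathlib

/-- The Newton polyhedron `Γ₊(f)` at the origin: the convex hull of the union of the shifted
orthants `m + ℝ₊ⁿ`, for `m` in the support of `f`. -/
def newtonPolyhedron {n : ℕ} (f : MvPolynomial (Fin n) ℂ) : Set (Fin n → ℝ) :=
  convexHull ℝ (⋃ m ∈ f.support, {v | ∀ i, (m i : ℝ) ≤ v i})

/-- `F` is a facet of the polyhedron `P`: a non-empty face of dimension `dim P - 1`. -/
def IsPolyhedronFacet {ι : Type*} (P F : Set (ι → ℝ)) : Prop :=
  IsExposed ℝ P F ∧ F.Nonempty ∧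
    Module.finrank ℝ (vectorSpan ℝ F) + 1 = Module.finrank ℝ (vectorSpan ℝ P)

/-- The convex hull in `ℝⁿ` of finitely many lattice points. It is a simplex with these vertices
when they are affinely independent. -/
def latticeHull {κ ι : Type*} (A : κ → ι → ℤ) : Set (ι → ℝ) :=
  convexHull ℝ (Set.range fun k i => (A k i : ℝ))

/-- The lattice `V ∩ ℤⁿ` of integral points of a linear subspace `V` of `ℝⁿ`. -/
def integralPoints {ι : Type*} (V : Submodule ℝ (ι → ℝ)) : Submodule ℤ (ι → ℤ) where
  carrier := {m | (fun i => (m i : ℝ)) ∈ V}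
  zero_mem' := by
    have h : (fun i => (((0 : ι → ℤ) i : ℤ) : ℝ)) = 0 := by ext; simp
    simp only [Set.mem_ofPred_eq, h, V.zero_mem]
  add_mem' := by
    intro a b ha hb
    have h : (fun i => (((a + b) i : ℤ) : ℝ)) = (fun i => (a i : ℝ)) + fun i => (b i : ℝ) := by
      ext; simp
    simp only [Set.mem_ofPred_eq, h]
    exact V.add_mem ha hb
  smul_mem' := by
    intro c a ha
    have h : (fun i => (((c • a) i : ℤ) : ℝ)) = (c : ℝ) • fun i => (a i : ℝ) := by
      ext; simp
    simp only [Set.mem_ofPred_eq, h]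
    exact V.smul_mem _ ha

/-- The normalized volume `Vol_ℤ(σ)` of a non-empty lattice polytope `σ`: `d!` times its Lebesgue
measure in coordinates on `aff(σ)` given by a `ℤ`-basis of the lattice of integral points of the
direction of `aff(σ)`, where `d` is the rank of this lattice, which is the dimension of `σ`.
The value depends neither on the basis nor on the base point, and it is an integer, so that
the rounding changes nothing. -/
noncomputable def normalizedVolume {ι : Type*} [Finite ι] (σ : Set (ι → ℝ)) : ℕ :=
  let L := integralPoints (vectorSpan ℝ σ)
  let b := Module.finBasis ℤ L
  let p : ι → ℝ := Classical.epsilon (· ∈ σ)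
  ⌊((Module.finrank ℤ L).factorial : ℝ) *
    (MeasureTheory.volume {x : Fin (Module.finrank ℤ L) → ℝ |
      (fun i => p i + ∑ j, x j * (((b j : L) : ι → ℤ) i : ℝ)) ∈ σ}).toReal⌋₊

/-- The lattice distance `N(σ)` of `aff(σ)` from the origin, for a lattice polytope `σ` whose
affine span does not contain the origin: the constant value on `σ` of the primitive linear form
on the linear span of `σ` that is constant on `σ` with a positive value. A form is primitive if
it maps the integral points of the linear span onto `ℤ`. -/
noncomputable def latticeDistance {ι : Type*} (σ : Set (ι → ℝ)) : ℕ :=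
  sInf {N : ℕ | ∃ l : (ι → ℝ) →ₗ[ℝ] ℝ, (∀ v ∈ σ, l v = N) ∧
    (fun m : ι → ℤ => l fun i => (m i : ℝ)) '' (integralPoints (Submodule.span ℝ σ) : Set (ι → ℤ))
      = Set.range ((↑) : ℤ → ℝ)}

/-- `a` is the primitive conormal vector of a polytope `τ` of codimension one in the positive
orthant. -/
def IsPrimitiveConormal {ι : Type*} [Fintype ι] (τ : Set (ι → ℝ)) (a : ι → ℤ) : Prop :=
  (∀ i, 0 ≤ a i) ∧ Finset.univ.gcd a = 1 ∧
    ∃ c : ℝ, ∀ v ∈ τ, ∑ i, (a i : ℝ) * v i = c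

/-- The primitive conormal vector `a(τ)`. -/
noncomputable def primitiveConormal {ι : Type*} [Fintype ι] (τ : Set (ι → ℝ)) : ι → ℤ :=
  Classical.epsilon (IsPrimitiveConormal τ)

/-- `ν(τ) = |a(τ)|`, the sum of the coordinates of the primitive conormal vector. -/
noncomputable def conormalSum {ι : Type*} [Fintype ι] (τ : Set (ι → ℝ)) : ℤ :=
  ∑ i, primitiveConormal τ i

/-- `ζ_σ(t) = (1 - t ^ N(σ)) ^ Vol_ℤ(σ)`. -/
noncomputable def zetaPolynomial {ι : Type*} [Finite ι] (σ : Set (ι → ℝ)) : Polynomial ℂ :=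
  (1 - Polynomial.X ^ latticeDistance σ) ^ normalizedVolume σ

/-- The part `τ ∩ {v_i = 0 (i ∈ I)}` of `τ` cut out by coordinate hyperplanes. -/
def coordinateSection {ι : Type*} (τ : Set (ι → ℝ)) (I : Finset ι) : Set (ι → ℝ) :=
  τ ∩ {v | ∀ i ∈ I, v i = 0}

open Classical in
/-- The indices `i₁ < ⋯ < i_r`: those `i` for which `τ ∩ {v_i = 0}` is a facet of `τ`. -/
noncomputable def cornerIndices {ι : Type*} [Fintype ι] (τ : Set (ι → ℝ)) : Finset ι :=
  Finset.univ.filter fun i => IsPolyhedronFacet τ (coordinateSection τ {i})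

/-- `τ` has a (non-empty) corner of codimension `r`. -/
def HasCorner {ι : Type*} [Fintype ι] (τ : Set (ι → ℝ)) (r : ℕ) : Prop :=
  (cornerIndices τ).card = r ∧ (coordinateSection τ (cornerIndices τ)).Nonempty

/-- The rational function `F_τ(t)`, the product over `I ⊆ {i₁, …, i_r}` of
`ζ_{τ ∩ {v_i = 0 (i ∈ I)}}(t) ^ ((-1) ^ |I|)`. -/
noncomputable def cornerFunction {ι : Type*} [Fintype ι] (τ : Set (ι → ℝ)) : RatFunc ℂ :=
  ∏ I ∈ (cornerIndices τ).powerset,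
    (algebraMap (Polynomial ℂ) (RatFunc ℂ) (zetaPolynomial (coordinateSection τ I))) ^
      ((-1 : ℤ) ^ I.card)

/-- `τ` is a `B₁`-pyramid of compact type for the variable `v_i`: it is a compact pyramid over
`τ ∩ {v_i = 0}` whose apex `P` has height one over `{v_i = 0}`. -/
def IsB1PyramidCompactType {ι : Type*} (τ : Set (ι → ℝ)) (i : ι) : Prop :=
  IsCompact τ ∧ ∃ P : ι → ℝ, P i = 1 ∧ τ = convexHull ℝ (insert P (τ ∩ {v | v i = 0}))

/-- `τ` is a `B₁`-pyramid of non-compact type: for some non-empty set `S` of indices it is stable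
under adding vectors of `ℝ₊^S`, and its projection along `ℝ^S` is a `B₁`-pyramid of compact
type for some variable `v_i` with `i ∉ S`. -/
def IsB1PyramidNoncompactType {ι : Type*} (τ : Set (ι → ℝ)) : Prop :=
  ∃ S : Set ι, S.Nonempty ∧
    (∀ v ∈ τ, ∀ w : ι → ℝ, (∀ i, 0 ≤ w i) → (∀ i ∉ S, w i = 0) → v + w ∈ τ) ∧
    ∃ i : {i // i ∉ S},
      IsB1PyramidCompactType ((fun (v : ι → ℝ) (j : {j // j ∉ S}) => v j) '' τ) i

/-- `B₁`-pyramids, for `τ` a polyhedron of codimension one in the positive orthant. -/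
def IsB1Pyramid {ι : Type*} (τ : Set (ι → ℝ)) : Prop :=
  (∃ i, IsB1PyramidCompactType τ i) ∨ IsB1PyramidNoncompactType τ

/-! The vertices of `τ` lie on a hyperplane that misses the origin, so they form a basis `β` of
`ℝⁿ`. Let `Λ` be the lattice that they generate, `G = ℤⁿ/Λ` (a finite group), and `u` the linear
form equal to `1` on every vertex. The coordinates in `β` are well defined modulo `ℤ` on `G`, and `χ
= exp(2πi u)` is a character of `G`.

For a face `σ` with vertex set `J`, let `G_J` be the group of classes whose coordinates outside `J`
are integral; it consists of the classes of the integral points of the span of `σ`. On `G_J` the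
character `χ` has image `μ_N` with `N = N(σ)`, and its kernel has order `Vol_ℤ(σ)`. Hence `ζ_σ(t) =
∏ (1 - χ(q) t)` over `q ∈ G_J` (`zetaPolynomial_eq_prod`).

Each corner index `i` leaves exactly one vertex off `{v_i = 0}`, its apex. By inclusion-exclusion,
`F_τ(t)` is the product of `1 - χ(q) t` over those `q` whose coordinate at every apex is
non-integral (`cornerFunction_eq_prod`), which is a polynomial.

Since `a(τ) = N(τ) u`, the class of `(1, …, 1)` has `χ = exp(2πi ν(τ)/N(τ)) = λ⁻¹`. Its coordinate
at the apex for `i` is the inverse of the height of that apex over `{v_i = 0}`. This is an integer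
only for height one, that is, only if `τ` is a `B₁`-pyramid. Otherwise the factor `1 - λ⁻¹ t` occurs
in `F_τ`. -/

/-! ### Volume of the standard simplex -/

open MeasureTheory in
/-- The simplex cut out of the positive orthant of `ℝᵈ` by `∑ xᵢ ≤ s` has volume `s ^ d / d!`. -/
theorem volume_orthant_sum_le (d : ℕ) {s : ℝ} (hs : 0 ≤ s) :
    volume {x : Fin d → ℝ | (∀ i, 0 ≤ x i) ∧ ∑ i, x i ≤ s} =
      ENNReal.ofReal (s ^ d / d.factorial) := by
  induction d generalizing s with
  | zero => simp [hs, volume_pi]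
  | succ d ih =>
    have hmeas : ∀ (d : ℕ) (s : ℝ),
        MeasurableSet {x : Fin d → ℝ | (∀ i, 0 ≤ x i) ∧ ∑ i, x i ≤ s} := fun d s => by
      apply IsClosed.measurableSet
      have h1 : IsClosed {x : Fin d → ℝ | ∑ i, x i ≤ s} := isClosed_le (by fun_prop) (by fun_prop)
      have h2 : IsClosed {x : Fin d → ℝ | ∀ i, 0 ≤ x i} := by
        simp only [Set.ofPred_forall]
        exact isClosed_iInter fun i => isClosed_le (by fun_prop) (by fun_prop)
      exact h2.inter h1
    have hmp := (volume_preserving_piFinSuccAbove (fun _ : Fin (d + 1) => ℝ) 0).symm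
    rw [← hmp.measure_preimage (hmeas _ _).nullMeasurableSet, Measure.volume_eq_prod,
      Measure.prod_apply (hmp.measurable (hmeas _ _))]
    -- The slice at first coordinate `a` is a simplex of size `s - a`, and it is empty for `a`
    -- outside `[0, s]`.
    have hslice : ∀ a : ℝ, volume (Prod.mk a ⁻¹'
        ((MeasurableEquiv.piFinSuccAbove (fun _ : Fin (d + 1) => ℝ) 0).symm ⁻¹'
          {x | (∀ i, 0 ≤ x i) ∧ ∑ i, x i ≤ s})) =
        (Set.Icc 0 s).indicator
          (fun a => ENNReal.ofReal ((s - a) ^ d / d.factorial)) a := by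
      intro a
      have hset : Prod.mk a ⁻¹'
        ((MeasurableEquiv.piFinSuccAbove (fun _ : Fin (d + 1) => ℝ) 0).symm ⁻¹'
          {x | (∀ i, 0 ≤ x i) ∧ ∑ i, x i ≤ s}) =
          {x : Fin d → ℝ | 0 ≤ a ∧ (∀ i, 0 ≤ x i) ∧ ∑ i, x i ≤ s - a} := by
        ext x
        simp [MeasurableEquiv.piFinSuccAbove, Fin.forall_fin_succ, Fin.sum_univ_succ,
          Fin.insertNthEquiv, and_assoc, le_sub_iff_add_le, add_comm]
      rw [hset]
      by_cases ha : a ∈ Set.Icc 0 s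
      · rw [Set.indicator_of_mem ha, ← ih (sub_nonneg.2 ha.2)]
        simp [ha.1]
      · rw [Set.indicator_of_notMem ha]
        convert! measure_empty (μ := volume)
        ext x
        simp only [Set.mem_ofPred_eq, Set.mem_empty_iff_false, iff_false]
        rintro ⟨h0, h1, h2⟩
        exact ha ⟨h0, by linarith [Finset.sum_nonneg fun i (_ : i ∈ Finset.univ) => h1 i]⟩
    simp_rw [hslice]
    rw [lintegral_indicator measurableSet_Icc, ← ofReal_integral_eq_lintegral_ofReal]
    · congr 1
      rw [integral_Icc_eq_integral_Ioc, ← intervalIntegral.integral_of_le hs,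
        intervalIntegral.integral_comp_sub_left (fun x => x ^ d / (d.factorial : ℝ)) s]
      simp only [sub_self, sub_zero, intervalIntegral.integral_div, integral_pow]
      rw [Nat.factorial_succ]
      push_cast
      field_simp
      simp
    · exact ContinuousOn.integrableOn_Icc (by fun_prop)
    · filter_upwards [ae_restrict_mem measurableSet_Icc] with a ha
      have := sub_nonneg.2 ha.2
      positivity

/-! ### Products over the values of a character -/

open Polynomial in
/-- The product of `1 - χ(g) t` over a finite abelian group `H`, for a character `χ` of order
`N`. -/
theorem AddChar.prod_one_sub_C_mul_X {H : Type*} [AddCommGroup H] [Fintype H]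
    (χ : AddChar H ℂ) {N : ℕ} [NeZero N] (hχ : ∀ h, χ h ^ N = 1)
    {h₀ : H} (h₀N : IsPrimitiveRoot (χ h₀) N) :
    ∏ h, (1 - C (χ h) * X) = (1 - X ^ N) ^ Nat.card {h // χ h = 1} := by
  classical
  have hN : 0 < N := Nat.pos_of_ne_zero (NeZero.ne N)
  have hprod : ∏ ζ ∈ nthRootsFinset N (1 : ℂ), (1 - C ζ * X) = (1 - X ^ N : ℂ[X]) := by
    have h := h₀N.map_of_injective (f := (C : ℂ →+* ℂ[X])) C_injective
    have := h.pow_sub_pow_eq_prod_sub_mul (1 : ℂ[X]) X hN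
    rw [one_pow] at this
    have himage : (nthRootsFinset N (1 : ℂ)).image (C : ℂ →+* ℂ[X]) =
        nthRootsFinset N (1 : ℂ[X]) := by
      refine Finset.eq_of_subset_of_card_le (fun p hp => ?_) ?_
      · obtain ⟨ζ, hζ, rfl⟩ := Finset.mem_image.1 hp
        exact map_mem_nthRootsFinset_one hζ _
      · rw [Finset.card_image_of_injective _ C_injective, h₀N.card_nthRootsFinset,
          h.card_nthRootsFinset]
    rw [this, ← himage, Finset.prod_image fun x _ y _ hxy => C_injective hxy]
  rw [← hprod, ← Finset.prod_pow]
  rw [← Finset.prod_fiberwise_of_maps_to (s := Finset.univ) (t := nthRootsFinset N (1 : ℂ))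
    (g := χ) (fun h _ => (mem_nthRootsFinset hN _).2 (hχ h))]
  refine Finset.prod_congr rfl fun ζ hζ => ?_
  obtain ⟨i, -, hi⟩ := h₀N.eq_pow_of_pow_eq_one ((mem_nthRootsFinset hN _).1 hζ)
  rw [Finset.prod_congr rfl fun h hh => by rw [(Finset.mem_filter.1 hh).2], Finset.prod_const]
  congr 1
  rw [Nat.card_eq_fintype_card, Fintype.card_subtype]
  -- As `ζ = χ(h₀) ^ i`, translation by `i • h₀` identifies the kernel with the fibre over `ζ`, so
  -- each root of unity occurs equally often.
  refine Finset.card_bij' (fun h _ => h - i • h₀) (fun h _ => h + i • h₀) ?_ ?_ ?_ ?_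
  · intro h hh
    have : χ h = ζ := by simpa using hh
    have hζ0 : ζ ≠ 0 := hi ▸ pow_ne_zero _ (h₀N.ne_zero (NeZero.ne N))
    simp [AddChar.map_sub_eq_div, AddChar.map_nsmul_eq_pow, this, hi, hζ0]
  · intro h hh
    have : χ h = 1 := by simpa using hh
    simp [AddChar.map_add_eq_mul, AddChar.map_nsmul_eq_pow, this, hi]
  · simp
  · simp

/-- The inclusion of `ℤⁿ` into `ℝⁿ`. -/
def intVec (ι : Type*) : (ι → ℤ) →+ (ι → ℝ) := (Int.castAddHom ℝ).compLeft ι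

theorem intVec_apply {ι : Type*} (m : ι → ℤ) : intVec ι m = fun i => (m i : ℝ) := rfl

theorem intVec_injective (ι : Type*) : Function.Injective (intVec ι) := fun x y h => by
  ext i
  exact Int.cast_injective (α := ℝ) (congrFun h i)

theorem mem_integralPoints {ι : Type*} {V : Submodule ℝ (ι → ℝ)} {m : ι → ℤ} :
    m ∈ integralPoints V ↔ intVec ι m ∈ V := Iff.rfl

/-! ### Faces of a simplex in the coordinates of its vertex basis -/

section Face

variable {E κ : Type*} [AddCommGroup E] [Module ℝ E] (β : Module.Basis κ ℝ E)

theorem Module.Basis.mem_span_image_iff_repr (J : Set κ) (v : E) :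
    v ∈ Submodule.span ℝ (β '' J) ↔ ∀ k ∉ J, β.repr v k = 0 := by
  rw [β.mem_span_image]
  constructor
  · intro h k hk
    by_contra h0
    exact hk (h (by simpa using h0))
  · intro h k hk
    by_contra h0
    exact (by simpa using hk : β.repr v k ≠ 0) (h k h0)

theorem Module.Basis.sumCoords_eq_sum_repr [Fintype κ] (v : E) : β.sumCoords v = ∑ k, β.repr v k := by
  simp [-Module.Basis.coe_sumCoords]

theorem Module.Basis.mem_convexHull_image_iff_repr [Fintype κ] (J : Set κ) (v : E) :
    v ∈ convexHull ℝ (β '' J) ↔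
      (∀ k, 0 ≤ β.repr v k) ∧ (∀ k ∉ J, β.repr v k = 0) ∧ β.sumCoords v = 1 := by
  classical
  constructor
  · intro h
    let S : Set E := {v | (∀ k, 0 ≤ β.repr v k) ∧ (∀ k ∉ J, β.repr v k = 0) ∧ β.sumCoords v = 1}
    have hS : Convex ℝ S := by
      rintro x ⟨hx1, hx2, hx3⟩ y ⟨hy1, hy2, hy3⟩ a b ha hb hab
      refine ⟨fun k => ?_, fun k hk => ?_, ?_⟩
      · simp only [map_add, map_smul, Finsupp.add_apply, Finsupp.smul_apply, smul_eq_mul]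
        exact add_nonneg (mul_nonneg ha (hx1 k)) (mul_nonneg hb (hy1 k))
      · simp [hx2 k hk, hy2 k hk]
      · rw [map_add, map_smul, map_smul, hx3, hy3, smul_eq_mul, smul_eq_mul, mul_one, mul_one, hab]
    refine convexHull_min ?_ hS h
    rintro _ ⟨k, hk, rfl⟩
    refine ⟨fun j => ?_, fun j hj => ?_, by simp⟩
    · rw [β.repr_self, Finsupp.single_apply]
      split_ifs <;> simp
    · rw [β.repr_self, Finsupp.single_apply, if_neg (by rintro rfl; exact hj hk)]
  · rintro ⟨h1, h2, h3⟩
    have hsum : ∀ g : κ → E, (∑ k, β.repr v k • g k) =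
        ∑ k ∈ Finset.univ.filter (· ∈ J), β.repr v k • g k := fun g => by
      rw [Finset.sum_filter_of_ne]
      intro k _ hk
      by_contra hkJ
      simp [h2 k hkJ] at hk
    rw [← β.sum_repr v, hsum]
    refine (convex_convexHull ℝ _).sum_mem (fun k _ => h1 k) ?_ fun k hk =>
      subset_convexHull ℝ _ ⟨k, by simpa using hk, rfl⟩
    rw [Finset.sum_filter_of_ne, ← β.sumCoords_eq_sum_repr, h3]
    intro k _ hk
    by_contra hkJ
    exact hk (h2 k hkJ)

theorem Module.Basis.span_convexHull_image (J : Set κ) :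
    Submodule.span ℝ (convexHull ℝ (β '' J)) = Submodule.span ℝ (β '' J) :=
  le_antisymm (Submodule.span_le.2 <|
    convexHull_min Submodule.subset_span (Submodule.span ℝ (β '' J)).convex)
    (Submodule.span_mono (subset_convexHull ℝ _))

theorem Module.Basis.eq_vertex_add_sum_edges [Fintype κ] (v : E) (k₀ : κ) :
    v = β.sumCoords v • β k₀ + ∑ k, β.repr v k • (β k - β k₀) := by
  simp only [smul_sub, Finset.sum_sub_distrib, β.sum_repr, ← Finset.sum_smul,
    ← β.sumCoords_eq_sum_repr]
  abel

theorem Module.Basis.mem_vectorSpan_image_iff_repr [Fintype κ] {J : Set κ} (hJ : J.Nonempty) (v : E) :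
    v ∈ vectorSpan ℝ (convexHull ℝ (β '' J)) ↔
      (∀ k ∉ J, β.repr v k = 0) ∧ β.sumCoords v = 0 := by
  obtain ⟨k₀, hk₀⟩ := hJ
  rw [← direction_affineSpan, affineSpan_convexHull, direction_affineSpan]
  constructor
  · intro h
    let S : Submodule ℝ E := Submodule.span ℝ (β '' J) ⊓ LinearMap.ker β.sumCoords
    have : vectorSpan ℝ (β '' J) ≤ S := by
      refine Submodule.span_le.2 ?_
      rintro _ ⟨_, ⟨j, hj, rfl⟩, _, ⟨k, hk, rfl⟩, rfl⟩
      exact ⟨sub_mem (Submodule.subset_span ⟨j, hj, rfl⟩) (Submodule.subset_span ⟨k, hk, rfl⟩),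
        by simp⟩
    exact ⟨(β.mem_span_image_iff_repr J v).1 (this h).1, (this h).2⟩
  · rintro ⟨h1, h2⟩
    rw [β.eq_vertex_add_sum_edges v k₀, h2, zero_smul, zero_add]
    refine sum_mem fun k _ => ?_
    by_cases hk : k ∈ J
    · exact Submodule.smul_mem _ _ (vsub_mem_vectorSpan ℝ ⟨k, hk, rfl⟩ ⟨k₀, hk₀, rfl⟩)
    · simp [h1 k hk]

end Face

/-! ### The lattice generated by the vertices -/

section Lattice

variable {ι κ : Type*} (β : Module.Basis κ ℝ (ι → ℝ))

/-- The coordinates modulo `ℤ` with respect to the basis `β` of the integral vectors. -/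
noncomputable def coordAngle (k : κ) : (ι → ℤ) →+ UnitAddCircle :=
  ((QuotientAddGroup.mk' (AddSubgroup.zmultiples (1 : ℝ))).comp
    (β.coord k).toAddMonoidHom).comp (intVec ι)

theorem coordAngle_apply (k : κ) (m : ι → ℤ) :
    coordAngle β k m = ((β.repr (intVec ι m) k : ℝ) : UnitAddCircle) := rfl

theorem UnitAddCircle.coe_eq_zero_iff {x : ℝ} : (x : UnitAddCircle) = 0 ↔ ∃ z : ℤ, (z : ℝ) = x := by
  rw [AddCircle.coe_eq_zero_iff]
  simp

/-- The lattice of the integral vectors with integral coordinates in the basis `β`. -/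
noncomputable def vertexLattice : AddSubgroup (ι → ℤ) := ⨅ k, (coordAngle β k).ker

theorem mem_vertexLattice {m : ι → ℤ} :
    m ∈ vertexLattice β ↔ ∀ k, ∃ z : ℤ, (z : ℝ) = β.repr (intVec ι m) k := by
  simp only [vertexLattice, AddSubgroup.mem_iInf, AddMonoidHom.mem_ker, coordAngle_apply,
    UnitAddCircle.coe_eq_zero_iff]

variable {β}

theorem vertex_mem_vertexLattice {A : κ → ι → ℤ} (hA : ∀ k, intVec ι (A k) = β k) (k : κ) :
    A k ∈ vertexLattice β := by
  classical
  rw [mem_vertexLattice]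
  intro j
  rw [hA, β.repr_self, Finsupp.single_apply]
  exact ⟨if k = j then 1 else 0, by split_ifs <;> simp⟩

theorem repr_sum_zsmul [Fintype κ] {A : κ → ι → ℤ} (hA : ∀ k, intVec ι (A k) = β k)
    (z : κ → ℤ) (k : κ) :
    β.repr (intVec ι (∑ j, z j • A j)) k = z k := by
  have : intVec ι (∑ j, z j • A j) = ∑ j, (z j : ℝ) • β j := by
    simp only [map_sum, map_zsmul, hA, Int.cast_smul_eq_zsmul]
  rw [this, β.repr_sum_self]

/-- The vertices are a `ℤ`-basis of the vertex lattice, which therefore has full rank in `ℤⁿ`. -/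
theorem vertexLattice_index_ne_zero [Finite ι] [Fintype κ] {A : κ → ι → ℤ}
    (hA : ∀ k, intVec ι (A k) = β k) : (vertexLattice β).index ≠ 0 := by
  have := Fintype.ofFinite ι
  have hcard : Fintype.card κ = Fintype.card ι := by
    simpa using (Module.finrank_eq_card_basis β).symm
  have e : κ ≃ ι := Fintype.equivOfCardEq hcard
  rw [Int.addSubgroup_index_ne_zero_iff]
  let f : (κ → ℤ) →+ vertexLattice β :=
    { toFun := fun z => ⟨∑ j, z j • A j, sum_mem fun j _ =>
        zsmul_mem (vertex_mem_vertexLattice hA j) _⟩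
      map_zero' := by simp
      map_add' := fun x y => by
        ext1
        simp [add_smul, Finset.sum_add_distrib] }
  have hf : Function.Bijective f := by
    constructor
    · intro x y hxy
      ext k
      have h : (∑ j, x j • A j) = ∑ j, y j • A j := congrArg Subtype.val hxy
      have := repr_sum_zsmul hA x k
      rw [h, repr_sum_zsmul hA y k] at this
      exact_mod_cast this.symm
    · rintro ⟨m, hm⟩
      choose z hz using (mem_vertexLattice β).1 hm
      refine ⟨z, Subtype.ext (intVec_injective ι (β.repr.injective (Finsupp.ext fun k => ?_)))⟩
      exact (repr_sum_zsmul hA z k).trans (hz k)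
  exact ⟨(AddEquiv.ofBijective f hf).symm.trans (AddEquiv.arrowCongr e (AddEquiv.refl ℤ))⟩

end Lattice

/-! ### Normalized volume as a lattice index -/

theorem LinearIndependent.of_intVec {ι κ : Type*} {e : κ → ι → ℤ}
    (he : LinearIndependent ℝ fun k => intVec ι (e k)) : LinearIndependent ℤ e := by
  have h : LinearIndependent ℤ fun k => intVec ι (e k) :=
    he.restrict_scalars (by intro a b hab; simpa using hab)
  exact LinearIndependent.of_comp (intVec ι).toIntLinearMap h

open MeasureTheory in
/-- The volume of a simplex with integral edges `e k` at one of its vertices, in coordinates with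
respect to a basis of a lattice `L` containing the edges. -/
theorem factorial_mul_volume_simplex {ι κ : Type*} [Fintype κ] {L : Submodule ℤ (ι → ℤ)} {d : ℕ}
    (b : Module.Basis (Fin d) ℤ L) (e : κ → L)
    (he : LinearIndependent ℝ fun k => intVec ι (e k))
    (hidx : (Submodule.span ℤ (Set.range e)).toAddSubgroup.index ≠ 0)
    {σ : Set (ι → ℝ)} {p p₀ : ι → ℝ}
    (hσ : ∀ y : κ → ℝ, p₀ + ∑ k, y k • intVec ι (e k) ∈ σ ↔ (∀ k, 0 ≤ y k) ∧ ∑ k, y k ≤ 1)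
    (hp : ∃ y : κ → ℝ, p = p₀ + ∑ k, y k • intVec ι (e k)) :
    (d.factorial : ℝ) * (volume {x : Fin d → ℝ |
      (fun i => p i + ∑ j, x j * (((b j : L) : ι → ℤ) i : ℝ)) ∈ σ}).toReal =
      (Submodule.span ℤ (Set.range e)).toAddSubgroup.index := by
  classical
  have heL : LinearIndependent ℤ e :=
    LinearIndependent.of_comp L.subtype he.of_intVec
  have hfree : Module.Free ℤ L := Module.Free.of_basis b
  have hfin : Module.Finite ℤ L := Module.Finite.of_basis b
  let N := Submodule.span ℤ (Set.range e)
  let bN : Module.Basis κ ℤ N := Module.Basis.span heL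
  have hcard : Fintype.card κ = d := by
    have : N.toAddSubgroup.FiniteIndex := ⟨hidx⟩
    have h := AddSubgroup.finrank_eq_of_finiteIndex N.toAddSubgroup
    have h1 : Module.finrank ℤ N.toAddSubgroup = Fintype.card κ :=
      Module.finrank_eq_card_basis bN
    rw [← h1, h, Module.finrank_eq_card_basis b, Fintype.card_fin]
  let r : Fin d ≃ κ := (Fintype.equivFinOfCardEq hcard).symm
  let C : Matrix (Fin d) (Fin d) ℤ := b.toMatrix (e ∘ r)
  have hdet : C.det.natAbs = N.toAddSubgroup.index := by
    have h := Submodule.natAbs_det_basis_change b N (bN.reindex r.symm)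
    rw [Module.Basis.det_apply] at h
    have h2 : ((↑) ∘ (bN.reindex r.symm) : Fin d → L) = e ∘ r := by
      ext1 j
      simp only [Function.comp_apply, Module.Basis.reindex_apply, Equiv.symm_symm]
      exact congrArg Subtype.val (Module.Basis.span_apply heL (r j))
    rw [h2] at h
    exact h
  have hdet0 : C.det ≠ 0 := by
    intro h0
    rw [h0] at hdet
    exact hidx hdet.symm
  let D : Matrix (Fin d) (Fin d) ℝ := C.map (Int.cast : ℤ → ℝ)
  have hD : D.det = C.det := (Int.cast_det C).symm
  have hD0 : D.det ≠ 0 := by rw [hD]; exact_mod_cast hdet0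
  have hDu : IsUnit D.det := hD0.isUnit
  have hedge : ∀ j, intVec ι (e (r j)) = ∑ i, D i j • intVec ι (b i) := fun j => by
    have h := b.sum_toMatrix_smul_self (e ∘ r) j
    have h' := congrArg (fun v : L => intVec ι v) h
    simp only [Function.comp_apply] at h'
    rw [← h']
    simp only [D, C, Matrix.map_apply, Submodule.coe_sum, Submodule.coe_smul, map_sum, map_zsmul,
      Int.cast_smul_eq_zsmul]
  have hbasis : ∀ y : Fin d → ℝ, ∑ i, (D.mulVec y) i • intVec ι (b i) =
      ∑ j, y j • intVec ι (e (r j)) := fun y => by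
    simp only [hedge, Matrix.mulVec, dotProduct, Finset.sum_smul, Finset.smul_sum, smul_smul]
    rw [Finset.sum_comm]
    simp only [mul_comm]
  obtain ⟨q, hq⟩ := hp
  -- The columns of `D` express the edges in the basis `b`, so `D⁻¹` passes to edge coordinates. The
  -- base point `p` only contributes the translation by `q`, and the volume is that of the standard
  -- simplex times `|det D|`, the index of the edge lattice.
  have hset : {x : Fin d → ℝ | (fun i => p i + ∑ j, x j * (((b j : L) : ι → ℤ) i : ℝ)) ∈ σ} =
      Matrix.toLin' D⁻¹ ⁻¹' ((fun y => y + q ∘ r) ⁻¹'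
        {y : Fin d → ℝ | (∀ i, 0 ≤ y i) ∧ ∑ i, y i ≤ 1}) := by
    ext x
    have hx : (fun i => p i + ∑ j, x j * (((b j : L) : ι → ℤ) i : ℝ)) =
        p₀ + ∑ k, ((D⁻¹.mulVec x + q ∘ r) ∘ r.symm) k • intVec ι (e k) := by
      have h1 : ∑ k, ((D⁻¹.mulVec x + q ∘ r) ∘ r.symm) k • intVec ι (e k) =
          ∑ j, (D⁻¹.mulVec x + q ∘ r) j • intVec ι (e (r j)) := by
        rw [← Equiv.sum_comp r]
        simp
      have h2 : ∑ j, (D⁻¹.mulVec x) j • intVec ι (e (r j)) = ∑ j, x j • intVec ι (b j) := by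
        rw [← hbasis, Matrix.mulVec_mulVec, Matrix.mul_nonsing_inv _ hDu, Matrix.one_mulVec]
      have h3 : ∑ j, (q ∘ r) j • intVec ι (e (r j)) = ∑ k, q k • intVec ι (e k) :=
        Equiv.sum_comp r fun k => q k • intVec ι (e k)
      rw [h1]
      simp only [Pi.add_apply, add_smul, Finset.sum_add_distrib, h2, h3]
      rw [hq]
      ext i
      simp only [Pi.add_apply, Finset.sum_apply, Pi.smul_apply, smul_eq_mul, intVec_apply]
      ring
    simp only [Set.mem_ofPred_eq, Set.mem_preimage, Matrix.toLin'_apply]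
    rw [hx, hσ, ← Equiv.sum_comp r, ← r.forall_congr_right]
    simp
  have hdetinv : LinearMap.det (Matrix.toLin' D⁻¹) = (C.det : ℝ)⁻¹ := by
    rw [LinearMap.det_toLin', Matrix.det_nonsing_inv, Ring.inverse_eq_inv', hD]
  rw [hset, Measure.addHaar_preimage_linearMap _
      (by rw [hdetinv]; exact inv_ne_zero (by exact_mod_cast hdet0)),
    measure_preimage_add_right, volume_orthant_sum_le d zero_le_one, hdetinv, inv_inv,
    ← ENNReal.ofReal_mul (abs_nonneg _), ENNReal.toReal_ofReal (by positivity), ← hdet,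
    Nat.cast_natAbs, Int.cast_abs]
  field_simp
  simp

/-- The edges at a vertex `β k₀` form a `ℤ`-basis of the part of the vertex lattice in the direction
of the face: a vector there has integral coordinates, supported on `J` and of sum zero, so the
coordinate at `k₀` is determined by the others. -/
theorem normalizedVolume_convexHull_image {ι κ : Type*} [Finite ι] [Fintype κ]
    {β : Module.Basis κ ℝ (ι → ℝ)} {A : κ → ι → ℤ} (hA : ∀ k, intVec ι (A k) = β k)
    {J : Set κ} (hJ : J.Nonempty) :
    normalizedVolume (convexHull ℝ (β '' J)) = (vertexLattice β).relIndex
      (integralPoints (vectorSpan ℝ (convexHull ℝ (β '' J)))).toAddSubgroup := by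
  classical
  set σ := convexHull ℝ (β '' J) with hσdef
  obtain ⟨k₀, hk₀⟩ := hJ
  set L := integralPoints (vectorSpan ℝ σ) with hL
  have hmemL : ∀ m, m ∈ L ↔ (∀ k ∉ J, β.repr (intVec ι m) k = 0) ∧
      β.sumCoords (intVec ι m) = 0 := fun m => by
    rw [hL, mem_integralPoints, hσdef, β.mem_vectorSpan_image_iff_repr ⟨k₀, hk₀⟩]
  let e : {k // k ∈ J ∧ k ≠ k₀} → L := fun k => ⟨A k - A k₀, by
    rw [hL, mem_integralPoints, map_sub, hA, hA]
    exact vsub_mem_vectorSpan ℝ (subset_convexHull ℝ _ ⟨k, k.2.1, rfl⟩)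
      (subset_convexHull ℝ _ ⟨k₀, hk₀, rfl⟩)⟩
  have hecoe : ∀ k, intVec ι (e k) = β k - β k₀ := fun k => by
    simp only [e, map_sub, hA]
  have hrepr : ∀ (y : {k // k ∈ J ∧ k ≠ k₀} → ℝ) (j : {k // k ∈ J ∧ k ≠ k₀}),
      β.repr (∑ k, y k • intVec ι (e k)) j = y j := fun y j => by
    simp only [hecoe, map_sum, map_smul, map_sub, β.repr_self, Finsupp.finsetSum_apply,
      Finsupp.smul_apply, Finsupp.sub_apply, Finsupp.single_apply, smul_eq_mul,
      if_neg (Ne.symm j.2.2), sub_zero]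
    simp [← Subtype.ext_iff]
  have hrepr_out : ∀ (y : {k // k ∈ J ∧ k ≠ k₀} → ℝ), ∀ j ∉ J,
      β.repr (∑ k, y k • intVec ι (e k)) j = 0 := fun y j hj => by
    simp only [hecoe, map_sum, map_smul, map_sub, β.repr_self, Finsupp.finsetSum_apply,
      Finsupp.smul_apply, Finsupp.sub_apply, Finsupp.single_apply, smul_eq_mul]
    refine Finset.sum_eq_zero fun k _ => ?_
    rw [if_neg (by rintro rfl; exact hj k.2.1), if_neg (by rintro rfl; exact hj hk₀)]
    simp
  have hrepr₀ : ∀ (y : {k // k ∈ J ∧ k ≠ k₀} → ℝ),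
      β.repr (∑ k, y k • intVec ι (e k)) k₀ = - ∑ k, y k := fun y => by
    simp only [hecoe, map_sum, map_smul, map_sub, β.repr_self, Finsupp.finsetSum_apply,
      Finsupp.smul_apply, Finsupp.sub_apply, Finsupp.single_apply, smul_eq_mul]
    rw [← Finset.sum_neg_distrib]
    refine Finset.sum_congr rfl fun k _ => ?_
    rw [if_neg k.2.2]
    simp
  have hsum0 : ∀ (y : {k // k ∈ J ∧ k ≠ k₀} → ℝ),
      β.sumCoords (∑ k, y k • intVec ι (e k)) = 0 := fun y => by
    rw [map_sum]
    refine Finset.sum_eq_zero fun k _ => ?_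
    rw [hecoe, map_smul, map_sub, β.sumCoords_self_apply, β.sumCoords_self_apply, sub_self,
      smul_zero]
  have hexp : ∀ v : ι → ℝ, (∀ k ∉ J, β.repr v k = 0) → β.sumCoords v = 0 →
      v = ∑ k : {k // k ∈ J ∧ k ≠ k₀}, β.repr v k • intVec ι (e k) := fun v h1 h2 => by
    conv_lhs => rw [β.eq_vertex_add_sum_edges v k₀, h2, zero_smul, zero_add]
    simp only [hecoe]
    rw [← Finset.sum_subtype (Finset.univ.filter fun k => k ∈ J ∧ k ≠ k₀) (by simp)
      fun k => β.repr v k • (β k - β k₀), Finset.sum_filter_of_ne]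
    intro k _ hk
    constructor
    · by_contra hkJ
      exact hk (by rw [h1 k hkJ, zero_smul])
    · rintro rfl
      exact hk (by rw [sub_self, smul_zero])
  have he : LinearIndependent ℝ fun k => intVec ι (e k) := by
    rw [Fintype.linearIndependent_iff]
    intro g hg j
    rw [← hrepr g j, hg]
    simp
  have hspan : (Submodule.span ℤ (Set.range e)).toAddSubgroup =
      (vertexLattice β).addSubgroupOf L.toAddSubgroup := by
    ext m
    change m ∈ Submodule.span ℤ (Set.range e) ↔ (m : ι → ℤ) ∈ vertexLattice β
    constructor
    · intro hm
      have : Submodule.span ℤ (Set.range e) ≤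
          AddSubgroup.toIntSubmodule ((vertexLattice β).comap L.subtype.toAddMonoidHom) := by
        refine Submodule.span_le.2 ?_
        rintro _ ⟨k, rfl⟩
        exact sub_mem (vertex_mem_vertexLattice hA _) (vertex_mem_vertexLattice hA _)
      exact this hm
    · intro hm
      choose z hz using (mem_vertexLattice β).1 hm
      have hmL := (hmemL m).1 m.2
      have : m = ∑ k : {k // k ∈ J ∧ k ≠ k₀}, z k • e k := by
        refine Subtype.ext (intVec_injective ι ?_)
        rw [hexp _ hmL.1 hmL.2]
        simp only [← hz, Submodule.coe_sum, Submodule.coe_smul, map_sum, map_zsmul,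
          Int.cast_smul_eq_zsmul]
      rw [this]
      exact sum_mem fun k _ => Submodule.smul_mem _ _ (Submodule.subset_span ⟨k, rfl⟩)
  have hidx : (Submodule.span ℤ (Set.range e)).toAddSubgroup.index ≠ 0 := by
    rw [hspan]
    intro h0
    refine vertexLattice_index_ne_zero hA ?_
    rw [← AddSubgroup.relIndex_top_right]
    exact AddSubgroup.relIndex_eq_zero_of_le_right le_top h0
  have hk₀σ : β k₀ ∈ σ := subset_convexHull ℝ _ ⟨k₀, hk₀, rfl⟩
  have hp : Classical.epsilon (· ∈ σ) ∈ σ := Classical.epsilon_spec ⟨_, hk₀σ⟩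
  have key := factorial_mul_volume_simplex (Module.finBasis ℤ L) e he hidx (σ := σ)
    (p := Classical.epsilon (· ∈ σ)) (p₀ := β k₀) (fun y => by
      rw [hσdef, β.mem_convexHull_image_iff_repr]
      constructor
      · rintro ⟨h1, -, -⟩
        refine ⟨fun k => ?_, ?_⟩
        · have := h1 k
          rw [map_add, Finsupp.add_apply, hrepr, β.repr_self, Finsupp.single_apply,
            if_neg (Ne.symm k.2.2), zero_add] at this
          exact this
        · have := h1 k₀
          rw [map_add, Finsupp.add_apply, hrepr₀, β.repr_self, Finsupp.single_eq_same] at this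
          linarith
      · rintro ⟨h1, h2⟩
        refine ⟨fun k => ?_, fun k hk => ?_, ?_⟩
        · rw [map_add, Finsupp.add_apply, β.repr_self]
          by_cases hk : k ∈ J
          · by_cases hkk : k = k₀
            · subst hkk
              rw [hrepr₀, Finsupp.single_eq_same]
              linarith
            · rw [hrepr y ⟨k, hk, hkk⟩, Finsupp.single_apply, if_neg (Ne.symm hkk), zero_add]
              exact h1 _
          · rw [hrepr_out y k hk, add_zero, Finsupp.single_apply]
            split_ifs <;> simp
        · rw [map_add, Finsupp.add_apply, β.repr_self, hrepr_out y k hk,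
            Finsupp.single_apply, if_neg (by rintro rfl; exact hk hk₀), add_zero]
        · rw [map_add, hsum0, β.sumCoords_self_apply, add_zero])
    ⟨fun k => β.repr (Classical.epsilon (· ∈ σ)) k, by
      have h := (β.mem_convexHull_image_iff_repr J _).1 hp
      rw [← sub_eq_iff_eq_add']
      conv_lhs => rw [hexp (Classical.epsilon (· ∈ σ) - β k₀) (fun k hk => by
        rw [map_sub, Finsupp.sub_apply, h.2.1 k hk, β.repr_self, Finsupp.single_apply,
          if_neg (by rintro rfl; exact hk hk₀), sub_zero]) (by
        rw [map_sub, h.2.2, β.sumCoords_self_apply, sub_self])]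
      refine Finset.sum_congr rfl fun k _ => ?_
      rw [map_sub, Finsupp.sub_apply, β.repr_self, Finsupp.single_apply, if_neg (Ne.symm k.2.2),
        sub_zero]⟩
  change ⌊_⌋₊ = _
  rw [key, Nat.floor_natCast, hspan]
  rfl

/-! ### Lattice distance and the form equal to one on the vertices -/

section Distance

variable {ι κ : Type*} {β : Module.Basis κ ℝ (ι → ℝ)}

theorem mem_integralPoints_span {J : Set κ} {m : ι → ℤ} :
    m ∈ integralPoints (Submodule.span ℝ (convexHull ℝ (β '' J))) ↔
      ∀ k ∉ J, β.repr (intVec ι m) k = 0 := by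
  rw [mem_integralPoints, β.span_convexHull_image, β.mem_span_image_iff_repr]

/-- The form that is equal to `1` on the basis maps the lattice of a face onto `N⁻¹ ℤ`, for some
`N`. -/
theorem exists_height_denominator [Finite ι] [Fintype κ] {A : κ → ι → ℤ}
    (hA : ∀ k, intVec ι (A k) = β k) {J : Set κ} (hJ : J.Nonempty) :
    ∃ N : ℕ, 0 < N ∧
      (∃ m : ι → ℤ, (∀ k ∉ J, β.repr (intVec ι m) k = 0) ∧ N * β.sumCoords (intVec ι m) = 1) ∧
      ∀ m : ι → ℤ, (∀ k ∉ J, β.repr (intVec ι m) k = 0) →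
        ∃ z : ℤ, (z : ℝ) = N * β.sumCoords (intVec ι m) := by
  classical
  obtain ⟨k₀, hk₀⟩ := hJ
  set d := (vertexLattice β).index with hd
  have hd0 : d ≠ 0 := vertexLattice_index_ne_zero hA
  have hint : ∀ m : ι → ℤ, ∃ z : ℤ, (z : ℝ) = d * β.sumCoords (intVec ι m) := fun m => by
    have := (mem_vertexLattice β).1 ((vertexLattice β).nsmul_index_mem m)
    choose z hz using this
    refine ⟨∑ k, z k, ?_⟩
    rw [Int.cast_sum, Finset.sum_congr rfl fun k _ => hz k, ← β.sumCoords_eq_sum_repr, map_nsmul,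
      map_nsmul, nsmul_eq_mul]
  -- `K` is the group of values of `d u` on the lattice of the face. It is `gℤ`, and it contains `d`
  -- because a vertex has height one. Writing `d = g c`, the form `c u` maps this lattice onto `ℤ`,
  -- so `N = |c|`.
  let K : AddSubgroup ℤ :=
    { carrier := {z | ∃ m : ι → ℤ, (∀ k ∉ J, β.repr (intVec ι m) k = 0) ∧
        (z : ℝ) = d * β.sumCoords (intVec ι m)}
      zero_mem' := ⟨0, fun k _ => by simp, by simp [-Module.Basis.coe_sumCoords]⟩
      add_mem' := by
        rintro a b ⟨m, hm, ha⟩ ⟨m', hm', hb⟩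
        refine ⟨m + m', fun k hk => by simp [hm k hk, hm' k hk], ?_⟩
        rw [Int.cast_add, ha, hb, map_add, map_add, mul_add]
      neg_mem' := by
        rintro a ⟨m, hm, ha⟩
        refine ⟨-m, fun k hk => by simp [hm k hk], ?_⟩
        rw [Int.cast_neg, ha, map_neg, map_neg, mul_neg] }
  obtain ⟨g, hg⟩ := Int.subgroup_cyclic K
  rw [← AddSubgroup.zmultiples_eq_closure] at hg
  have hdK : (d : ℤ) ∈ K := ⟨A k₀, fun k hk => by
    rw [hA, β.repr_self, Finsupp.single_apply, if_neg (by rintro rfl; exact hk hk₀)], by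
    rw [hA, β.sumCoords_self_apply]; simp⟩
  rw [hg, Int.mem_zmultiples_iff] at hdK
  obtain ⟨c, hc⟩ := hdK
  have hg0 : g ≠ 0 := by
    rintro rfl
    exact hd0 (by simpa using hc)
  have hc0 : c ≠ 0 := by
    rintro rfl
    exact hd0 (by simpa using hc)
  have hdR : (d : ℝ) = g * c := by exact_mod_cast hc
  have hgR : (g : ℝ) ≠ 0 := by exact_mod_cast hg0
  have habs : ((c.natAbs : ℕ) : ℝ) = c.sign * c := by
    rw [Nat.cast_natAbs]
    exact_mod_cast (Int.sign_mul_self_eq_abs c).symm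
  have hsign : (c.sign : ℝ) * c.sign = 1 := by
    have : c.sign * c.sign = 1 := by
      rcases Int.lt_or_gt_of_ne hc0 with h | h
      · simp [Int.sign_eq_neg_one_of_neg h]
      · simp [Int.sign_eq_one_of_pos h]
    exact_mod_cast this
  refine ⟨c.natAbs, Int.natAbs_pos.2 hc0, ?_, fun m hm => ?_⟩
  · have : c.sign * g ∈ K := by
      rw [hg, Int.mem_zmultiples_iff]
      exact Dvd.intro_left _ rfl
    obtain ⟨m, hm, h⟩ := this
    refine ⟨m, hm, ?_⟩
    rw [hdR] at h
    push_cast at h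
    have h' : (c.sign : ℝ) = c * β.sumCoords (intVec ι m) := by
      apply mul_left_cancel₀ hgR
      linarith
    rw [habs, mul_assoc, ← h', hsign]
  · obtain ⟨z, hz⟩ := hint m
    have : z ∈ K := ⟨m, hm, hz⟩
    rw [hg, Int.mem_zmultiples_iff] at this
    obtain ⟨y, rfl⟩ := this
    refine ⟨c.sign * y, ?_⟩
    rw [hdR] at hz
    push_cast at hz
    have h' : (y : ℝ) = c * β.sumCoords (intVec ι m) := by
      apply mul_left_cancel₀ hgR
      linarith
    rw [habs, Int.cast_mul, h']
    ring

/-- A form with value `n` on the face agrees with `n u` on its span. If both `n u` and `N u` map the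
lattice onto `ℤ`, then `n` and `N` divide each other, so the infimum in `latticeDistance` is over a
singleton. -/
theorem latticeDistance_eq [Fintype κ] {J : Set κ} {N : ℕ} {m₀ : ι → ℤ}
    (hm₀ : ∀ k ∉ J, β.repr (intVec ι m₀) k = 0) (hm₀N : N * β.sumCoords (intVec ι m₀) = 1)
    (hint : ∀ m : ι → ℤ, (∀ k ∉ J, β.repr (intVec ι m) k = 0) →
        ∃ z : ℤ, (z : ℝ) = N * β.sumCoords (intVec ι m)) :
    latticeDistance (convexHull ℝ (β '' J)) = N := by
  have hset : {n : ℕ | ∃ l : (ι → ℝ) →ₗ[ℝ] ℝ, (∀ v ∈ convexHull ℝ (β '' J), l v = n) ∧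
      (fun m : ι → ℤ => l fun i => (m i : ℝ)) '' (integralPoints (Submodule.span ℝ
        (convexHull ℝ (β '' J))) : Set (ι → ℤ)) = Set.range ((↑) : ℤ → ℝ)} = {N} := by
    ext n
    simp only [Set.mem_ofPred_eq, Set.mem_singleton_iff]
    constructor
    · rintro ⟨l, hl, himage⟩
      have hl' : ∀ m : ι → ℤ, (∀ k ∉ J, β.repr (intVec ι m) k = 0) →
          l (intVec ι m) = n * β.sumCoords (intVec ι m) := fun m hm => by
        conv_lhs => rw [← β.sum_repr (intVec ι m)]
        rw [map_sum, β.sumCoords_eq_sum_repr, Finset.mul_sum]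
        refine Finset.sum_congr rfl fun k _ => ?_
        by_cases hk : k ∈ J
        · rw [map_smul, hl _ (subset_convexHull ℝ _ ⟨k, hk, rfl⟩), smul_eq_mul, mul_comm]
        · rw [hm k hk]; simp
      have h1 : (1 : ℝ) ∈ Set.range ((↑) : ℤ → ℝ) := ⟨1, by simp⟩
      rw [← himage] at h1
      obtain ⟨m, hm, hlm⟩ := h1
      have hm' := mem_integralPoints_span.1 hm
      obtain ⟨z, hz⟩ := hint m hm'
      change l (intVec ι m) = 1 at hlm
      rw [hl' m hm'] at hlm
      have h2 : l (intVec ι m₀) ∈ Set.range ((↑) : ℤ → ℝ) := by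
        rw [← himage]
        exact ⟨m₀, mem_integralPoints_span.2 hm₀, rfl⟩
      obtain ⟨y, hy⟩ := h2
      rw [hl' m₀ hm₀] at hy
      have e1 : (n : ℤ) = y * N := by
        have : (n : ℝ) = y * N := by rw [hy]; linear_combination (-(n : ℝ)) * hm₀N
        exact_mod_cast this
      have e2 : (N : ℤ) = z * n := by
        have : (N : ℝ) = z * n := by rw [hz]; linear_combination (-(N : ℝ)) * hlm
        exact_mod_cast this
      exact Nat.dvd_antisymm (Int.natCast_dvd_natCast.1 ⟨z, by rw [e2, mul_comm]⟩)
        (Int.natCast_dvd_natCast.1 ⟨y, by rw [e1, mul_comm]⟩)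
    · rintro rfl
      refine ⟨(n : ℝ) • β.sumCoords, fun v hv => ?_, ?_⟩
      · rw [LinearMap.smul_apply, ((β.mem_convexHull_image_iff_repr J v).1 hv).2.2]
        simp
      · ext x
        constructor
        · rintro ⟨m, hm, rfl⟩
          exact hint m (mem_integralPoints_span.1 hm)
        · rintro ⟨z, rfl⟩
          refine ⟨z • m₀, Submodule.smul_mem _ z (mem_integralPoints_span.2 hm₀), ?_⟩
          change ((n : ℝ) • β.sumCoords) (intVec ι (z • m₀)) = z
          rw [LinearMap.smul_apply, map_zsmul, map_zsmul, smul_eq_mul, zsmul_eq_mul]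
          linear_combination (z : ℝ) * hm₀N
  rw [latticeDistance, hset, csInf_singleton]

theorem latticeDistance_spec [Finite ι] [Fintype κ] {A : κ → ι → ℤ}
    (hA : ∀ k, intVec ι (A k) = β k) {J : Set κ} (hJ : J.Nonempty) :
    0 < latticeDistance (convexHull ℝ (β '' J)) ∧
      (∃ m : ι → ℤ, (∀ k ∉ J, β.repr (intVec ι m) k = 0) ∧
        latticeDistance (convexHull ℝ (β '' J)) * β.sumCoords (intVec ι m) = 1) ∧
      ∀ m : ι → ℤ, (∀ k ∉ J, β.repr (intVec ι m) k = 0) →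
        ∃ z : ℤ, (z : ℝ) = latticeDistance (convexHull ℝ (β '' J)) *
          β.sumCoords (intVec ι m) := by
  obtain ⟨N, hN, ⟨m, hm, hmN⟩, hint⟩ := exists_height_denominator hA hJ
  rw [latticeDistance_eq hm hmN hint]
  exact ⟨hN, ⟨m, hm, hmN⟩, hint⟩

end Distance

/-! ### The finite group of classes, its height character and the zeta functions -/

section Classes

variable {ι κ : Type*} (β : Module.Basis κ ℝ (ι → ℝ))

/-- The coordinates modulo `ℤ` as homomorphisms on the classes modulo the vertex lattice. -/
noncomputable def coordClass (k : κ) : (ι → ℤ) ⧸ vertexLattice β →+ UnitAddCircle :=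
  QuotientAddGroup.lift _ (coordAngle β k) (iInf_le _ k)

theorem coordClass_mk (k : κ) (m : ι → ℤ) :
    coordClass β k (m : (ι → ℤ) ⧸ vertexLattice β) =
      ((β.repr (intVec ι m) k : ℝ) : UnitAddCircle) := rfl

/-- The character `m ↦ exp (2πi u(m))`, for the linear form `u` that is equal to `1` on the
basis `β`. -/
noncomputable def heightCharacter [Fintype κ] : AddChar ((ι → ℤ) ⧸ vertexLattice β) ℂ where
  toFun q := AddCircle.toCircle (∑ k, coordClass β k q)
  map_zero_eq_one' := by simp
  map_add_eq_mul' x y := by simp [Finset.sum_add_distrib, AddCircle.toCircle_add]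

theorem heightCharacter_mk [Fintype κ] (m : ι → ℤ) :
    heightCharacter β (m : (ι → ℤ) ⧸ vertexLattice β) =
      Complex.exp (2 * Real.pi * Complex.I * β.sumCoords (intVec ι m)) := by
  have h : ∑ k, coordClass β k (m : (ι → ℤ) ⧸ vertexLattice β) =
      ((β.sumCoords (intVec ι m) : ℝ) : UnitAddCircle) := by
    rw [β.sumCoords_eq_sum_repr]
    simp only [coordClass_mk]
    exact (map_sum (QuotientAddGroup.mk' (AddSubgroup.zmultiples (1 : ℝ))) _ _).symm
  change ((AddCircle.toCircle (∑ k, coordClass β k (m : (ι → ℤ) ⧸ vertexLattice β)) : Circle) : ℂ)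
    = _
  rw [h, AddCircle.toCircle_apply_mk, Circle.coe_exp]
  congr 1
  push_cast
  ring

theorem heightCharacter_mk_eq_one_iff [Fintype κ] (m : ι → ℤ) :
    heightCharacter β (m : (ι → ℤ) ⧸ vertexLattice β) = 1 ↔
      ∃ z : ℤ, (z : ℝ) = β.sumCoords (intVec ι m) := by
  rw [heightCharacter_mk, Complex.exp_eq_one_iff]
  refine exists_congr fun z => ?_
  rw [mul_comm, mul_left_inj' Complex.two_pi_I_ne_zero, eq_comm]
  norm_cast

/-- The classes that are represented by integral points of the span of the face with vertices
`β k`, `k ∈ J`. -/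
noncomputable def faceClasses (J : Set κ) : AddSubgroup ((ι → ℤ) ⧸ vertexLattice β) :=
  ⨅ k ∈ Jᶜ, (coordClass β k).ker

theorem mem_faceClasses {J : Set κ} {q : (ι → ℤ) ⧸ vertexLattice β} :
    q ∈ faceClasses β J ↔ ∀ k ∉ J, coordClass β k q = 0 := by
  simp [faceClasses, AddSubgroup.mem_iInf]

variable {β}

/-- Subtracting integral multiples of the vertices outside `J` turns integral coordinates there into
zero ones without changing the class. -/
theorem mem_faceClasses_iff_exists [Fintype κ] {A : κ → ι → ℤ}
    (hA : ∀ k, intVec ι (A k) = β k) {J : Set κ} {q : (ι → ℤ) ⧸ vertexLattice β} :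
    q ∈ faceClasses β J ↔
      ∃ m : ι → ℤ, (∀ k ∉ J, β.repr (intVec ι m) k = 0) ∧ (m : (ι → ℤ) ⧸ vertexLattice β) = q := by
  classical
  rw [mem_faceClasses]
  constructor
  · obtain ⟨m, rfl⟩ := QuotientAddGroup.mk_surjective q
    intro h
    simp only [coordClass_mk, UnitAddCircle.coe_eq_zero_iff] at h
    choose! z hz using h
    refine ⟨m - ∑ k, (if k ∈ J then 0 else z k) • A k, fun k hk => ?_, ?_⟩
    · rw [map_sub, map_sub, Finsupp.sub_apply, repr_sum_zsmul hA, if_neg hk, hz k hk, sub_self]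
    · rw [QuotientAddGroup.eq]
      rw [neg_sub, sub_add_cancel]
      exact sum_mem fun k _ => zsmul_mem (vertex_mem_vertexLattice hA k) _
  · rintro ⟨m, hm, rfl⟩ k hk
    rw [coordClass_mk, hm k hk, AddCircle.coe_zero]

open Polynomial in
/-- The function `ζ_σ` of a face is the product of `1 - χ(q) t` over the classes of the face, where
`χ` is the height character. -/
theorem zetaPolynomial_eq_prod [Finite ι] [Fintype κ] {A : κ → ι → ℤ}
    (hA : ∀ k, intVec ι (A k) = β k) {J : Set κ} (hJ : J.Nonempty)
    [Fintype (faceClasses β J)] :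
    zetaPolynomial (convexHull ℝ (β '' J)) =
      ∏ q : faceClasses β J, (1 - C (heightCharacter β q) * X) := by
  classical
  obtain ⟨hN, ⟨m₀, hm₀, hm₀N⟩, hint⟩ := latticeDistance_spec hA hJ
  rw [zetaPolynomial, normalizedVolume_convexHull_image hA hJ]
  set N := latticeDistance (convexHull ℝ (β '' J)) with hNdef
  have hNe : NeZero N := ⟨hN.ne'⟩
  have hNC : (N : ℂ) ≠ 0 := by exact_mod_cast hN.ne'
  let χ : AddChar (faceClasses β J) ℂ :=
    (heightCharacter β).compAddMonoidHom (faceClasses β J).subtype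
  have hχ : ∀ h, χ h ^ N = 1 := by
    rintro ⟨q, hq⟩
    obtain ⟨m, hm, rfl⟩ := (mem_faceClasses_iff_exists hA).1 hq
    obtain ⟨z, hz⟩ := hint m hm
    rw [← AddChar.map_nsmul_eq_pow]
    change heightCharacter β ((N • m : ι → ℤ) : (ι → ℤ) ⧸ vertexLattice β) = 1
    rw [heightCharacter_mk_eq_one_iff]
    exact ⟨z, by rw [hz, map_nsmul, map_nsmul, nsmul_eq_mul]⟩
  have hroot : IsPrimitiveRoot (χ ⟨m₀, (mem_faceClasses_iff_exists hA).2 ⟨m₀, hm₀, rfl⟩⟩) N := by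
    have h : (β.sumCoords (intVec ι m₀) : ℂ) = 1 / N := by
      rw [eq_div_iff hNC, mul_comm]
      exact_mod_cast hm₀N
    change IsPrimitiveRoot (heightCharacter β (m₀ : (ι → ℤ) ⧸ vertexLattice β)) N
    rw [heightCharacter_mk, h, mul_one_div]
    exact Complex.isPrimitiveRoot_exp N hN.ne'
  -- The kernel of `χ` on the face classes is the image of the lattice of the direction: a
  -- representative of integral height `z` is moved to height zero by subtracting `z` times a
  -- vertex. The order of this image is the index that equals the normalized volume.
  have hmap : ∀ q, q ∈ (integralPoints (vectorSpan ℝ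
      (convexHull ℝ (β '' J)))).toAddSubgroup.map (QuotientAddGroup.mk' (vertexLattice β)) ↔
      q ∈ faceClasses β J ∧ heightCharacter β q = 1 := fun q => by
    rw [mem_faceClasses_iff_exists hA, AddSubgroup.mem_map]
    constructor
    · rintro ⟨m, hm, rfl⟩
      have hm' := (β.mem_vectorSpan_image_iff_repr hJ _).1 (mem_integralPoints.1 hm)
      exact ⟨⟨m, hm'.1, rfl⟩, (heightCharacter_mk_eq_one_iff β m).2 ⟨0, by rw [hm'.2]; simp⟩⟩
    · rintro ⟨⟨m, hm, rfl⟩, h1⟩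
      obtain ⟨z, hz⟩ := (heightCharacter_mk_eq_one_iff β m).1 h1
      obtain ⟨k₀, hk₀⟩ := hJ
      refine ⟨m - z • A k₀, ?_, ?_⟩
      · change m - z • A k₀ ∈ integralPoints _
        rw [mem_integralPoints, β.mem_vectorSpan_image_iff_repr ⟨k₀, hk₀⟩, map_sub, map_zsmul, hA]
        refine ⟨fun k hk => ?_, ?_⟩
        · rw [map_sub, map_zsmul, Finsupp.sub_apply, hm k hk, β.repr_self, Finsupp.smul_apply,
            Finsupp.single_apply, if_neg (by rintro rfl; exact hk hk₀), smul_zero, sub_zero]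
        · rw [map_sub, map_zsmul, β.sumCoords_self_apply, ← hz, zsmul_eq_mul, mul_one, sub_self]
      · rw [QuotientAddGroup.mk'_apply, QuotientAddGroup.eq, neg_sub, sub_add_cancel]
        exact zsmul_mem (vertex_mem_vertexLattice hA k₀) _
  have hker := AddSubgroup.relIndex_ker (integralPoints (vectorSpan ℝ
      (convexHull ℝ (β '' J)))).toAddSubgroup (QuotientAddGroup.mk' (vertexLattice β))
  rw [QuotientAddGroup.ker_mk'] at hker
  rw [hker]
  refine Eq.trans ?_ (χ.prod_one_sub_C_mul_X hχ hroot).symm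
  congr 1
  exact Nat.card_congr ((Equiv.subtypeEquivRight hmap).trans
    (Equiv.subtypeSubtypeEquivSubtypeInter _ fun q => heightCharacter β q = 1).symm)

end Classes

/-! ### Compact facets of the Newton polyhedron -/

section Newton

variable {n : ℕ} {f : MvPolynomial (Fin n) ℂ}

theorem newtonPolyhedron_subset_Ici : newtonPolyhedron f ⊆ Set.Ici 0 := by
  refine convexHull_min (Set.iUnion₂_subset fun m _ v hv i => ?_) (convex_Ici 0)
  exact (Nat.cast_nonneg (m i)).trans (hv i)

theorem add_mem_newtonPolyhedron {v w : Fin n → ℝ} (hv : v ∈ newtonPolyhedron f) (hw : 0 ≤ w) :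
    v + w ∈ newtonPolyhedron f := by
  have h : newtonPolyhedron f ⊆ (fun z => z + w) ⁻¹' newtonPolyhedron f := by
    refine convexHull_min (fun z hz => ?_)
      ((convex_convexHull ℝ _).translate_preimage_left w)
    obtain ⟨m, hm, hmz⟩ := Set.mem_iUnion₂.1 hz
    exact subset_convexHull ℝ _
      (Set.mem_iUnion₂.2 ⟨m, hm, fun i => (hmz i).trans (le_add_of_nonneg_right (hw i))⟩)
  exact h hv

/-- A compact facet of a Newton polyhedron is contained in a hyperplane with a positive conormal
vector that does not contain the origin. -/
theorem exists_pos_conormal (hf0 : MvPolynomial.eval 0 f = 0) {T : Set (Fin n → ℝ)}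
    (hT : IsPolyhedronFacet (newtonPolyhedron f) T) (hTc : IsCompact T) :
    ∃ (a : Fin n → ℝ) (c : ℝ), (∀ i, 0 < a i) ∧ 0 < c ∧ ∀ v ∈ T, ∑ i, a i * v i = c := by
  classical
  obtain ⟨hexp, ⟨t, ht⟩, -⟩ := hT
  obtain ⟨l, hl⟩ := hexp ⟨t, ht⟩
  have htP : t ∈ newtonPolyhedron f := by rw [hl] at ht; exact ht.1
  have htmax : ∀ y ∈ newtonPolyhedron f, l y ≤ l t := by rw [hl] at ht; exact ht.2
  have hsingle : ∀ (i : Fin n) (s : ℝ), 0 ≤ s →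
      t + Pi.single i s ∈ newtonPolyhedron f := fun i s hs =>
    add_mem_newtonPolyhedron htP (Pi.single_nonneg.2 hs)
  have hlsingle : ∀ (i : Fin n) (s : ℝ), l (Pi.single i s) = s * l (Pi.single i 1) := fun i s => by
    rw [← smul_eq_mul, ← map_smul, ← Pi.single_smul, smul_eq_mul, mul_one]
  -- If `l` vanished on the `i`-th unit vector, the facet would contain a ray in that direction,
  -- against compactness.
  have hneg : ∀ i, l (Pi.single i 1) < 0 := fun i => by
    have h1 := htmax _ (hsingle i 1 zero_le_one)
    rw [map_add] at h1
    refine lt_of_le_of_ne (by linarith) fun h0 => ?_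
    obtain ⟨B, hB⟩ := hTc.bddAbove_image (f := fun v : Fin n → ℝ => v i) (by fun_prop)
    have hmem : t + Pi.single i (|B| + |t i| + 1) ∈ T := by
      rw [hl]
      refine ⟨hsingle i _ (by positivity), fun y hy => ?_⟩
      rw [map_add, hlsingle, h0, mul_zero, add_zero]
      exact htmax y hy
    have := hB ⟨_, hmem, rfl⟩
    simp only [Pi.add_apply, Pi.single_eq_same] at this
    linarith [le_abs_self B, neg_abs_le (t i)]
  have hlsum : ∀ v : Fin n → ℝ, ∑ i, -l (Pi.single i 1) * v i = - l v := fun v => by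
    conv_rhs => rw [pi_eq_sum_univ' v]
    rw [map_sum, ← Finset.sum_neg_distrib]
    refine Finset.sum_congr rfl fun i _ => ?_
    rw [map_smul, smul_eq_mul]
    ring
  refine ⟨fun i => -l (Pi.single i 1), -l t, fun i => neg_pos.2 (hneg i), ?_, fun v hv => ?_⟩
  -- Since `f(0) = 0`, every exponent in the support has a positive coordinate, which makes `l`
  -- negative on its shifted orthant.
  · have hpos : newtonPolyhedron f ⊆ {v | l v < 0} := by
      refine convexHull_min (Set.iUnion₂_subset fun m hm v hv => ?_)
        (convex_halfSpace_lt l.toLinearMap.isLinear 0)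
      have hm0 : m ≠ 0 := by
        rintro rfl
        rw [MvPolynomial.mem_support_iff, ← MvPolynomial.constantCoeff_eq,
          ← MvPolynomial.eval_zero] at hm
        exact hm hf0
      obtain ⟨i, hi⟩ := Finsupp.ne_iff.1 hm0
      have hvi : ∀ j, (0 : ℝ) ≤ v j := fun j => (Nat.cast_nonneg (m j)).trans (hv j)
      have : 0 < - l v := by
        rw [← hlsum]
        refine Finset.sum_pos' (fun j _ => mul_nonneg (neg_nonneg.2 (hneg j).le) (hvi j))
          ⟨i, Finset.mem_univ i, mul_pos (neg_pos.2 (hneg i)) (lt_of_lt_of_le ?_ (hv i))⟩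
        exact_mod_cast Nat.pos_of_ne_zero hi
      exact neg_pos.1 this
    exact neg_pos.2 (hpos htP)
  · rw [hlsum]
    rw [hl] at hv
    rw [le_antisymm (htmax v hv.1) (hv.2 t htP)]

end Newton

/-- Applying `φ` to a linear relation shows that its coefficients sum to zero, so it is an affine
relation. -/
theorem AffineIndependent.linearIndependent_of_const {κ E : Type*} [AddCommGroup E] [Module ℝ E]
    {p : κ → E} (hp : AffineIndependent ℝ p) (φ : E →ₗ[ℝ] ℝ) {c : ℝ} (hc : c ≠ 0)
    (hφ : ∀ k, φ (p k) = c) : LinearIndependent ℝ p := by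
  rw [linearIndependent_iff']
  intro s g hg
  refine affineIndependent_iff.1 hp s g ?_ hg
  have h := congrArg φ hg
  simp only [map_sum, map_smul, hφ, smul_eq_mul, map_zero, ← Finset.sum_mul] at h
  exact (mul_eq_zero.1 h).resolve_right hc

/-! ### Coordinate sections, apices and pyramids -/

section Corner

variable {ι κ : Type*} [Fintype κ]

theorem Module.Basis.apply_eq_sum_repr_mul (β : Module.Basis κ ℝ (ι → ℝ)) (v : ι → ℝ) (i : ι) :
    v i = ∑ k, β.repr v k * β k i := by
  conv_lhs => rw [← β.sum_repr v]
  simp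

theorem Module.Basis.finrank_vectorSpan_image {E : Type*} [AddCommGroup E] [Module ℝ E]
    (β : Module.Basis κ ℝ E) {J : Set κ} (hJ : J.Nonempty) :
    Module.finrank ℝ (vectorSpan ℝ (convexHull ℝ (β '' J))) + 1 = J.ncard := by
  classical
  have hcard : J.toFinset.card = (J.ncard - 1) + 1 := by
    rw [← Set.ncard_eq_toFinset_card', Nat.sub_add_cancel]
    exact (Set.ncard_pos).2 hJ
  have h := β.linearIndependent.affineIndependent.finrank_vectorSpan_image_finset hcard
  rw [← direction_affineSpan, affineSpan_convexHull, direction_affineSpan]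
  rw [Finset.coe_image, Set.coe_toFinset] at h
  rw [h, Nat.sub_add_cancel ((Set.ncard_pos).2 hJ)]

variable {β : Module.Basis κ ℝ (ι → ℝ)}

/-- In the positive orthant a convex combination of vertices has `v_i = 0` only if each vertex that
occurs with non-zero weight does. -/
theorem coordinateSection_convexHull_range (hβ : ∀ k i, 0 ≤ β k i) (I : Finset ι) :
    coordinateSection (convexHull ℝ (Set.range β)) I =
      convexHull ℝ (β '' {k | ∀ i ∈ I, β k i = 0}) := by
  ext v
  rw [coordinateSection, ← Set.image_univ, Set.mem_inter_iff, β.mem_convexHull_image_iff_repr,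
    β.mem_convexHull_image_iff_repr]
  constructor
  · rintro ⟨⟨h1, -, h2⟩, h3⟩
    refine ⟨h1, fun k hk => ?_, h2⟩
    by_contra h0
    refine hk fun i hi => ?_
    have h4 := h3 i hi
    rw [β.apply_eq_sum_repr_mul v i, Finset.sum_eq_zero_iff_of_nonneg
      fun k _ => mul_nonneg (h1 k) (hβ k i)] at h4
    exact (mul_eq_zero.1 (h4 k (Finset.mem_univ k))).resolve_left h0
  · rintro ⟨h1, h2, h3⟩
    refine ⟨⟨h1, by simp, h3⟩, fun i hi => ?_⟩
    rw [β.apply_eq_sum_repr_mul v i]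
    refine Finset.sum_eq_zero fun k _ => ?_
    by_cases hk : ∀ i ∈ I, β k i = 0
    · rw [hk i hi, mul_zero]
    · rw [h2 k hk, zero_mul]

/-- If `τ ∩ {v_i = 0}` is a facet of the simplex `τ`, then exactly one vertex of `τ` is not in
it. -/
theorem exists_unique_vertex_off_facet (hβ : ∀ k i, 0 ≤ β k i) {i : ι}
    (hi : IsPolyhedronFacet (convexHull ℝ (Set.range β))
      (coordinateSection (convexHull ℝ (Set.range β)) {i})) :
    ∃ k, β k i ≠ 0 ∧ ∀ j, j ≠ k → β j i = 0 := by
  obtain ⟨-, hne, hrank⟩ := hi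
  rw [coordinateSection_convexHull_range hβ] at hne hrank
  have hset : {k | ∀ i' ∈ ({i} : Finset ι), β k i' = 0} = {k | β k i = 0} := by
    ext k; simp
  rw [hset] at hne hrank
  have hJ : {k | β k i = 0}.Nonempty := Set.image_nonempty.1 (convexHull_nonempty_iff.1 hne)
  have huniv : (Set.univ : Set κ).Nonempty := hJ.mono (Set.subset_univ _)
  have h1 := β.finrank_vectorSpan_image hJ
  have h2 := β.finrank_vectorSpan_image huniv
  rw [Set.image_univ] at h2
  have h3 := Set.ncard_add_ncard_compl {k | β k i = 0}
  rw [Set.ncard_univ] at h2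
  have h4 : ({k | β k i = 0}ᶜ : Set κ).ncard = 1 := by omega
  obtain ⟨k, hk⟩ := Set.ncard_eq_one.1 h4
  refine ⟨k, ?_, fun j hj => ?_⟩
  · have : k ∈ ({k | β k i = 0}ᶜ : Set κ) := by rw [hk]; rfl
    exact this
  · by_contra h0
    have : j ∈ ({k | β k i = 0}ᶜ : Set κ) := h0
    rw [hk] at this
    exact hj this

theorem isB1Pyramid_of_height_one {i : ι} {k : κ} (h1 : β k i = 1)
    (hk : ∀ j, j ≠ k → β j i = 0) : IsB1Pyramid (convexHull ℝ (Set.range β)) := by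
  refine Or.inl ⟨i, (Set.finite_range β).isCompact_convexHull (𝕜 := ℝ), β k, h1, ?_⟩
  apply subset_antisymm
  · refine convexHull_min ?_ (convex_convexHull ℝ _)
    rintro _ ⟨j, rfl⟩
    refine subset_convexHull ℝ _ ?_
    by_cases hj : j = k
    · exact Or.inl (by rw [hj])
    · exact Or.inr ⟨subset_convexHull ℝ _ ⟨j, rfl⟩, hk j hj⟩
  · refine convexHull_min (Set.insert_subset (subset_convexHull ℝ _ ⟨k, rfl⟩) ?_)
      (convex_convexHull ℝ _)
    exact Set.inter_subset_left

end Corner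

/-! ### Inclusion-exclusion for the corner function -/

theorem zpow_sum_eq_prod_zpow {F α : Type*} [Field F] {x : F} (hx : x ≠ 0) (s : Finset α)
    (e : α → ℤ) : x ^ (∑ i ∈ s, e i) = ∏ i ∈ s, x ^ e i := by
  classical
  induction s using Finset.induction_on with
  | empty => simp
  | insert a s ha ih => rw [Finset.sum_insert ha, Finset.prod_insert ha, zpow_add₀ hx, ih]

/-- This computes the total exponent of one factor `1 - χ(q) t` in `F_τ`, with `p i` saying that the
coordinate of `q` at the apex for `i` is integral. The sum runs over the subsets of `{i ∈ S | p i}`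
and cancels unless that set is empty. -/
theorem sum_powerset_filter_neg_one_pow_card {α : Type*} (S : Finset α) (p : α → Prop)
    [DecidablePred p] [DecidablePred fun I : Finset α => ∀ i ∈ I, p i] :
    ∑ I ∈ S.powerset, (if ∀ i ∈ I, p i then (-1 : ℤ) ^ I.card else 0) =
      if ∀ i ∈ S, ¬ p i then 1 else 0 := by
  classical
  rw [← Finset.sum_filter]
  have h : S.powerset.filter (fun I => ∀ i ∈ I, p i) = (S.filter p).powerset := by
    ext I
    simp only [Finset.mem_filter, Finset.mem_powerset, Finset.subset_iff]
    exact ⟨fun h i hi => ⟨h.1 hi, h.2 i hi⟩, fun h => ⟨fun i hi => (h hi).1, fun i hi => (h hi).2⟩⟩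
  rw [h, Finset.sum_powerset_neg_one_pow_card]
  simp only [Finset.filter_eq_empty_iff]

open Polynomial in
/-- The function of the corner is the product of `1 - χ(q) t` over the classes `q` with non-integral
coordinates at the vertices off the facets of the corner. -/
theorem cornerFunction_eq_prod {ι κ : Type*} [Fintype ι] [Fintype κ]
    {β : Module.Basis κ ℝ (ι → ℝ)} {A : κ → ι → ℤ} (hA : ∀ k, intVec ι (A k) = β k)
    (hβ : ∀ k i, 0 ≤ β k i) {apex : ι → κ}
    (hapex : ∀ i ∈ cornerIndices (convexHull ℝ (Set.range β)),
      β (apex i) i ≠ 0 ∧ ∀ j, j ≠ apex i → β j i = 0)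
    (hne : (coordinateSection (convexHull ℝ (Set.range β))
      (cornerIndices (convexHull ℝ (Set.range β)))).Nonempty)
    [Fintype ((ι → ℤ) ⧸ vertexLattice β)]
    [DecidablePred fun q : (ι → ℤ) ⧸ vertexLattice β =>
      ∀ i ∈ cornerIndices (convexHull ℝ (Set.range β)), coordClass β (apex i) q ≠ 0] :
    cornerFunction (convexHull ℝ (Set.range β)) = algebraMap ℂ[X] (RatFunc ℂ)
      (∏ q ∈ Finset.univ.filter fun q : (ι → ℤ) ⧸ vertexLattice β =>
        ∀ i ∈ cornerIndices (convexHull ℝ (Set.range β)), coordClass β (apex i) q ≠ 0,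
        (1 - C (heightCharacter β q) * X)) := by
  classical
  set S := cornerIndices (convexHull ℝ (Set.range β)) with hS
  let x : (ι → ℤ) ⧸ vertexLattice β → RatFunc ℂ := fun q =>
    algebraMap ℂ[X] (RatFunc ℂ) (1 - C (heightCharacter β q) * X)
  have hx : ∀ q, x q ≠ 0 := fun q h => by
    have h0 := (map_eq_zero_iff _ (IsFractionRing.injective ℂ[X] (RatFunc ℂ))).1 h
    simpa using congrArg (Polynomial.eval 0) h0
  have hfactor : ∀ I ∈ S.powerset,
      (algebraMap ℂ[X] (RatFunc ℂ)
        (zetaPolynomial (coordinateSection (convexHull ℝ (Set.range β)) I))) ^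
          ((-1 : ℤ) ^ I.card) =
      ∏ q, x q ^ (if ∀ i ∈ I, coordClass β (apex i) q = 0 then (-1 : ℤ) ^ I.card else 0) := by
    intro I hI
    rw [Finset.mem_powerset] at hI
    -- A vertex of the non-empty corner lies in the section for every `I ⊆ S`, so the product
    -- formula for `ζ` applies to each of them.
    have hJ : {k | ∀ i ∈ I, β k i = 0}.Nonempty := by
      rw [coordinateSection_convexHull_range hβ] at hne
      obtain ⟨k, hk⟩ := Set.image_nonempty.1 (convexHull_nonempty_iff.1 hne)
      exact ⟨k, fun i hi => hk i (hI hi)⟩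
    have hmem : ∀ q, q ∈ faceClasses β {k | ∀ i ∈ I, β k i = 0} ↔
        ∀ i ∈ I, coordClass β (apex i) q = 0 := fun q => by
      rw [mem_faceClasses]
      constructor
      · exact fun h i hi => h _ fun h0 => (hapex i (hI hi)).1 (h0 i hi)
      · intro h k hk
        simp only [Set.mem_ofPred_eq, not_forall] at hk
        obtain ⟨i, hi, hki⟩ := hk
        have : k = apex i := by
          by_contra hne
          exact hki ((hapex i (hI hi)).2 k hne)
        rw [this]
        exact h i hi
    rw [coordinateSection_convexHull_range hβ, zetaPolynomial_eq_prod hA hJ, map_prod,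
      ← Finset.prod_zpow]
    rw [← Finset.prod_subtype (Finset.univ.filter fun q => ∀ i ∈ I, coordClass β (apex i) q = 0)
      (p := fun q => q ∈ faceClasses β {k | ∀ i ∈ I, β k i = 0})
      (fun q => by rw [hmem]; simp) fun q => x q ^ ((-1 : ℤ) ^ I.card), Finset.prod_filter]
    refine Finset.prod_congr rfl fun q _ => ?_
    split_ifs <;> simp
  rw [cornerFunction, Finset.prod_congr rfl hfactor, Finset.prod_comm, map_prod,
    Finset.prod_filter]
  refine Finset.prod_congr rfl fun q _ => ?_
  rw [← zpow_sum_eq_prod_zpow (hx q),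
    sum_powerset_filter_neg_one_pow_card S fun i => coordClass β (apex i) q = 0]
  split_ifs <;> simp [x]

/-! ### The primitive conormal vector and the main theorem -/

/-- The sum of the coordinates of the primitive conormal vector, for a simplex that is the convex
hull of an integral basis. -/
theorem conormalSum_eq {ι κ : Type*} [Fintype ι] [Fintype κ] [Nonempty κ]
    {β : Module.Basis κ ℝ (ι → ℝ)} {A : κ → ι → ℤ} (hA : ∀ k, intVec ι (A k) = β k)
    (hβ : ∀ k i, 0 ≤ β k i) (hu : ∀ v : ι → ℝ, 0 ≤ v → 0 ≤ β.sumCoords v) :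
    (conormalSum (convexHull ℝ (Set.range β)) : ℝ) =
      latticeDistance (convexHull ℝ (Set.range β)) * β.sumCoords 1 := by
  classical
  obtain ⟨hN, ⟨m₀, -, hm₀⟩, hint⟩ := latticeDistance_spec hA Set.univ_nonempty
  rw [Set.image_univ] at hN hm₀ hint
  set τ := convexHull ℝ (Set.range β) with hτ
  set N := latticeDistance τ
  have hsingle : ∀ i, (Pi.single i 1 : ι → ℝ) = intVec ι (Pi.single i 1) := fun i => by
    ext j
    simp [intVec_apply, Pi.single_apply]
  -- `a₀` is the coefficient vector of `N u`. It is primitive because `N u` takes the value `1` at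
  -- the integral point `m₀`.
  choose a₀ ha₀ using fun i => hint (Pi.single i 1) (by simp)
  simp only [← hsingle] at ha₀
  have hform : ∀ v : ι → ℝ, ∑ i, (a₀ i : ℝ) * v i = N * β.sumCoords v := fun v => by
    conv_rhs => rw [pi_eq_sum_univ' v]
    rw [map_sum, Finset.mul_sum]
    refine Finset.sum_congr rfl fun i _ => ?_
    rw [ha₀, map_smul, smul_eq_mul]
    ring
  have hτ1 : ∀ v ∈ τ, β.sumCoords v = 1 := fun v hv => by
    rw [hτ, ← Set.image_univ] at hv
    exact ((β.mem_convexHull_image_iff_repr _ v).1 hv).2.2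
  have hgcd : Finset.univ.gcd a₀ = 1 := by
    have h1 : ∑ i, a₀ i * m₀ i = 1 := by
      have := (hform (intVec ι m₀)).trans hm₀
      simp only [intVec_apply] at this
      exact_mod_cast this
    have h2 : Finset.univ.gcd a₀ ∣ 1 := by
      rw [← h1]
      exact Finset.dvd_sum fun i _ => (Finset.gcd_dvd (Finset.mem_univ i)).mul_right _
    rw [← Finset.normalize_gcd, normalize_eq_one]
    exact isUnit_of_dvd_one h2
  have hprim : IsPrimitiveConormal τ a₀ := by
    refine ⟨fun i => ?_, hgcd, N, fun v hv => by rw [hform, hτ1 v hv, mul_one]⟩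
    have : (0 : ℝ) ≤ a₀ i := by
      rw [ha₀]
      exact mul_nonneg (Nat.cast_nonneg _) (hu _ (Pi.single_nonneg.2 zero_le_one))
    exact_mod_cast this
  obtain ⟨hpos, hgcd', c, hc⟩ : IsPrimitiveConormal τ (primitiveConormal τ) :=
    Classical.epsilon_spec ⟨a₀, hprim⟩
  set a := primitiveConormal τ
  obtain ⟨k₀⟩ := ‹Nonempty κ›
  have hck : ∀ k, ∑ i, (a i : ℝ) * β k i = c := fun k => hc _ (subset_convexHull ℝ _ ⟨k, rfl⟩)
  have hform' : ∀ v : ι → ℝ, ∑ i, (a i : ℝ) * v i = c * β.sumCoords v := fun v => by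
    have : ∀ i, v i = ∑ k, β.repr v k * β k i := β.apply_eq_sum_repr_mul v
    simp only [this, β.sumCoords_eq_sum_repr, Finset.mul_sum]
    rw [Finset.sum_comm]
    refine Finset.sum_congr rfl fun k _ => ?_
    rw [← hck k, Finset.sum_mul]
    refine Finset.sum_congr rfl fun i _ => ?_
    ring
  obtain ⟨z, hz⟩ : ∃ z : ℕ, (z : ℝ) = c := by
    have h0 : 0 ≤ ∑ i, a i * A k₀ i := Finset.sum_nonneg fun i _ => mul_nonneg (hpos i) (by
      have := hβ k₀ i
      rw [← hA] at this
      exact Int.cast_nonneg_iff.1 this)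
    obtain ⟨z, hz⟩ := Int.eq_ofNat_of_zero_le h0
    refine ⟨z, ?_⟩
    rw [← hck k₀, ← hA]
    simp only [intVec_apply]
    exact_mod_cast hz.symm
  have hprop : ∀ i, (N : ℤ) * a i = z * a₀ i := fun i => by
    have h : (a i : ℝ) = c * β.sumCoords (Pi.single i 1) := by
      rw [← hform']
      simp [Pi.single_apply]
    have h' : (N : ℝ) * a i = z * a₀ i := by
      rw [h, ha₀, hz]
      ring
    exact_mod_cast h'
  -- The chosen conormal vector `a` represents `c u`, so it is proportional to `a₀`; comparing the
  -- gcds of the coordinates forces equal multipliers.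
  have hNz : N = z := by
    have h := congrArg (Finset.univ.gcd) (funext hprop)
    rw [Finset.gcd_mul_left, Finset.gcd_mul_left, hgcd, hgcd', mul_one, mul_one,
      Int.normalize_coe_nat, Int.normalize_coe_nat] at h
    exact_mod_cast h
  rw [hNz, hz, ← hform' 1]
  simp [conormalSum, a]

/-- The simplex `τ = latticeHull A` has the `n` affinely independent lattice points `A k` as its
vertices, so it is of dimension `n - 1`. -/
theorem theorem4p3 (n : ℕ) (f : MvPolynomial (Fin n) ℂ) (hf : f ≠ 0)
    (hf0 : MvPolynomial.eval 0 f = 0)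
    (A : Fin n → Fin n → ℤ) (hA : AffineIndependent ℝ fun k i => (A k i : ℝ))
    (T : Set (Fin n → ℝ)) (hT : IsPolyhedronFacet (newtonPolyhedron f) T) (hTc : IsCompact T)
    (hAT : latticeHull A ⊆ T)
    (r : ℕ) (hr : 1 ≤ r) (hcorner : HasCorner (latticeHull A) r) :
    ∃ P : Polynomial ℂ,
      algebraMap (Polynomial ℂ) (RatFunc ℂ) P = cornerFunction (latticeHull A) ∧
      (¬ IsB1Pyramid (latticeHull A) →
        P.IsRoot (Complex.exp (-2 * Real.pi * Complex.I *
          ((conormalSum (latticeHull A) : ℂ) / (latticeDistance (latticeHull A) : ℂ))))) := by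
  classical
  obtain ⟨a, c, ha, hc, haT⟩ := exists_pos_conormal hf0 hT hTc
  have hAT' : ∀ k, intVec (Fin n) (A k) ∈ T := fun k =>
    hAT (subset_convexHull ℝ _ ⟨k, rfl⟩)
  let φ : (Fin n → ℝ) →ₗ[ℝ] ℝ := ∑ i, a i • LinearMap.proj i
  have hφ : ∀ v, φ v = ∑ i, a i * v i := fun v => by simp [φ]
  have hli : LinearIndependent ℝ fun k => intVec (Fin n) (A k) :=
    hA.linearIndependent_of_const φ hc.ne' fun k => (hφ _).trans (haT _ (hAT' k))
  obtain ⟨i₀, -⟩ : (cornerIndices (latticeHull A)).Nonempty :=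
    Finset.card_pos.1 (by rw [hcorner.1]; exact hr)
  have hnonempty : Nonempty (Fin n) := ⟨i₀⟩
  let β : Module.Basis (Fin n) ℝ (Fin n → ℝ) :=
    basisOfLinearIndependentOfCardEqFinrank hli (by simp)
  have hAβ : ∀ k, intVec (Fin n) (A k) = β k := fun k => by simp [β]
  have hβ : ∀ k i, 0 ≤ β k i := fun k i => by
    rw [← hAβ]
    exact newtonPolyhedron_subset_Ici (hT.1.subset (hAT' k)) i
  have hτ : latticeHull A = convexHull ℝ (Set.range β) := by
    rw [← funext hAβ]
    rfl
  have hu : ∀ v, c * β.sumCoords v = ∑ i, a i * v i := fun v => by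
    have h : c • β.sumCoords = φ := β.ext fun k => by
      rw [LinearMap.smul_apply, β.sumCoords_self_apply, hφ, ← hAβ, haT _ (hAT' k), smul_eq_mul,
        mul_one]
    rw [← hφ, ← h, LinearMap.smul_apply, smul_eq_mul]
  have hunonneg : ∀ v : Fin n → ℝ, 0 ≤ v → 0 ≤ β.sumCoords v := fun v hv => by
    refine nonneg_of_mul_nonneg_right ?_ hc
    rw [hu]
    exact Finset.sum_nonneg fun i _ => mul_nonneg (ha i).le (hv i)
  rw [hτ] at hcorner ⊢
  set S := cornerIndices (convexHull ℝ (Set.range β)) with hS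
  have hfacet : ∀ i ∈ S, ∃ k, β k i ≠ 0 ∧ ∀ j, j ≠ k → β j i = 0 := fun i hi =>
    exists_unique_vertex_off_facet hβ (by simpa [hS, cornerIndices] using hi)
  choose! apex hapex using hfacet
  have hfinite : Finite ((Fin n → ℤ) ⧸ vertexLattice β) :=
    AddSubgroup.index_ne_zero_iff_finite.1 (vertexLattice_index_ne_zero hAβ)
  have := Fintype.ofFinite ((Fin n → ℤ) ⧸ vertexLattice β)
  refine ⟨_, (cornerFunction_eq_prod hAβ hβ hapex hcorner.2).symm, fun hB => ?_⟩
  rw [Polynomial.IsRoot, Polynomial.eval_prod]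
  -- The vanishing factor belongs to the class of `(1, …, 1)`, where `N u` takes the value `ν(τ)`.
  refine Finset.prod_eq_zero (i := ((1 : Fin n → ℤ) : (Fin n → ℤ) ⧸ vertexLattice β)) ?_ ?_
  · refine Finset.mem_filter.2 ⟨Finset.mem_univ _, fun i hi h0 => hB ?_⟩
    rw [coordClass_mk, UnitAddCircle.coe_eq_zero_iff] at h0
    obtain ⟨z, hz⟩ := h0
    -- Only the apex contributes to the `i`-th entry of `(1, …, 1)`, so an integral coordinate `z`
    -- there is an integral inverse of the height of the apex.
    have h1 : (z : ℝ) * A (apex i) i = 1 := by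
      have h := β.apply_eq_sum_repr_mul (intVec (Fin n) 1) i
      rw [Finset.sum_eq_single (apex i) (fun j _ hj => by rw [(hapex i hi).2 j hj, mul_zero])
        (by simp), ← hz, ← hAβ] at h
      simpa [intVec_apply] using h.symm
    have h2 : z * A (apex i) i = 1 := by exact_mod_cast h1
    have h3 : 0 ≤ A (apex i) i := by
      have h := hβ (apex i) i
      rw [← hAβ] at h
      exact Int.cast_nonneg_iff.1 h
    have h4 : A (apex i) i = 1 := by
      rcases Int.isUnit_iff.1 (IsUnit.of_mul_eq_one_right z h2) with h | h <;> omega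
    refine isB1Pyramid_of_height_one (i := i) (k := apex i) ?_ (hapex i hi).2
    rw [← hAβ]
    change ((A (apex i) i : ℤ) : ℝ) = 1
    rw [h4, Int.cast_one]
  · have hN := (latticeDistance_spec hAβ Set.univ_nonempty).1
    rw [Set.image_univ] at hN
    have hNC : (latticeDistance (convexHull ℝ (Set.range β)) : ℂ) ≠ 0 := by
      exact_mod_cast hN.ne'
    have hν : (conormalSum (convexHull ℝ (Set.range β)) : ℂ) =
        latticeDistance (convexHull ℝ (Set.range β)) * β.sumCoords 1 := by
      exact_mod_cast congrArg (fun x : ℝ => (x : ℂ)) (conormalSum_eq hAβ hβ hunonneg)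
    have hone : intVec (Fin n) 1 = 1 := by
      ext i
      simp [intVec_apply]
    simp only [Polynomial.eval_sub, Polynomial.eval_one, Polynomial.eval_mul, Polynomial.eval_C,
      Polynomial.eval_X]
    rw [heightCharacter_mk, ← Complex.exp_add, hν, hone, mul_div_cancel_left₀ _ hNC, sub_eq_zero,
      eq_comm, Complex.exp_eq_one_iff]
    -- The exponents `2πi u(1)` and `-2πi u(1)` cancel exactly, so the multiple of `2πi` is zero.
    exact ⟨0, by push_cast; ring⟩
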